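/- Let $d\ge 0$ be an integer and let $\Omega\subset\mathbb R^d$ be a Borel set, with the Euclidean distance. Let $\mathcal P(\Omega)$ be the set of Borel probability measures on $\Omega$ and, for $\mu,\nu\in\mathcal P(\Omega)$, let $\Pi(\mu,\nu)$ be the set of Borel probability measures on $\Omega\times\Omega$ with marginals $\mu$ and $\nu$. For $1\le p<\infty$ let $$\mathcal W_p(\Omega)=\Big\{\mu\in\mathcal P(\Omega):\int_\Omega |x|^p\,d\mu<\infty\Big\},\qquad W_p(\mu,\nu)=\Big(\inf_{\gamma\in\Pi(\mu,\nu)}\int_{\Omega\times\Omega}|x-y|^p\,d\gamma\Big)^{1/p},$$ and let $$\mathcal W_\infty(\Omega)=\{\mu\in\mathcal P(\Omega):\operatorname{spt}\mu\text{ is bounded}\},\qquad W_\infty(\mu,\nu)=\inf_{\gamma\in\Pi(\mu,\nu)}\ \gamma\text{-}\operatorname*{ess\,sup}_{(x,y)\in\Omega\times\Omega}|x-y|,$$ where each $\mathcal W_p(\Omega)$, $1\le p\le\infty$, carries the topology of the distance $W_p$. A space is called locally compact if each of its points has a compact neighbourhood. Then: 1. For every $1\le p<\infty$, $\mathcal W_p(\Omega)$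 is compact if and only if $\Omega$ is compact. 2. If $\Omega$ is unbounded, then for every $1\le p<\infty$ the space $\mathcal W_p(\Omega)$ is not locally compact. 3. If $\Omega$ has more than one point, then $\mathcal W_\infty(\Omega)$ is not compact; if moreover $\Omega$ is not a discrete set, that is, some point of $\Omega$ is not isolated in $\Omega$ (as is the case for every domain, and every connected set, with more than one point), then $\mathcal W_\infty(\Omega)$ is not locally compact. -/

import Mathlib

open MeasureTheory
open scoped ENNReal

noncomputable section

/-- The set `Π(μ, ν)` of transport plans between two probability measures: the probability measures
on `X × X` with marginals `μ` and `ν`. -/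
def transportPlans {X : Type*} [MeasurableSpace X] (μ ν : ProbabilityMeasure X) :
    Set (ProbabilityMeasure (X × X)) :=
  {γ | (γ : Measure (X × X)).map Prod.fst = (μ : Measure X) ∧
    (γ : Measure (X × X)).map Prod.snd = (ν : Measure X)}

/-- `W_p(μ, ν) = (inf_{γ ∈ Π(μ, ν)} ∫ |x - y|^p dγ)^{1/p}`, for real `p`. -/
def wassersteinEDist {X : Type*} [PseudoEMetricSpace X] [MeasurableSpace X] (p : ℝ)
    (μ ν : ProbabilityMeasure X) : ℝ≥0∞ :=
  (⨅ γ ∈ transportPlans μ ν, ∫⁻ z, edist z.1 z.2 ^ p ∂(γ : Measure (X × X))) ^ (1 / p)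

/-- `W_∞(μ, ν) = inf_{γ ∈ Π(μ, ν)} γ-esssup |x - y|`. -/
def wassersteinInftyEDist {X : Type*} [PseudoEMetricSpace X] [MeasurableSpace X]
    (μ ν : ProbabilityMeasure X) : ℝ≥0∞ :=
  ⨅ γ ∈ transportPlans μ ν, essSup (fun z : X × X => edist z.1 z.2) (γ : Measure (X × X))

/-- The topology of a distance function `D`: a set is open if and only if it contains, with each of
its points `x`, an open ball `{y | D x y < ε}` with `ε > 0`. -/
@[reducible] def topologyOfEDist {X : Type*} (D : X → X → ℝ≥0∞) : TopologicalSpace X where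
  IsOpen U := ∀ x ∈ U, ∃ ε : ℝ≥0∞, 0 < ε ∧ ∀ y, D x y < ε → y ∈ U
  isOpen_univ := fun _ _ => ⟨1, one_pos, fun _ _ => Set.mem_univ _⟩
  isOpen_inter := by
    rintro U V hU hV x ⟨hxU, hxV⟩
    obtain ⟨ε, hε, hεU⟩ := hU x hxU
    obtain ⟨δ, hδ, hδV⟩ := hV x hxV
    exact ⟨min ε δ, lt_min hε hδ, fun y hy =>
      ⟨hεU y (hy.trans_le (min_le_left _ _)), hδV y (hy.trans_le (min_le_right _ _))⟩⟩
  isOpen_sUnion := by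
    rintro S hS x ⟨U, hUS, hxU⟩
    obtain ⟨ε, hε, hεU⟩ := hS U hUS x hxU
    exact ⟨ε, hε, fun y hy => ⟨U, hUS, hεU y hy⟩⟩

/-- The set `𝒲_p(Ω)` of Borel probability measures on `Ω` with finite `p`-th moment
`∫ |x|^p dμ`. -/
structure WassersteinSpace {d : ℕ} (Ω : Set (EuclideanSpace ℝ (Fin d))) (p : ℝ) where
  toProb : ProbabilityMeasure Ω
  moment_lt_top :
    ∫⁻ x : Ω, ‖(x : EuclideanSpace ℝ (Fin d))‖ₑ ^ p ∂(toProb : Measure Ω) < ∞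

/-- `𝒲_p(Ω)` carries the topology of the distance `W_p`. -/
instance {d : ℕ} (Ω : Set (EuclideanSpace ℝ (Fin d))) (p : ℝ) :
    TopologicalSpace (WassersteinSpace Ω p) :=
  topologyOfEDist fun μ ν => wassersteinEDist p μ.toProb ν.toProb

/-- The set `𝒲_∞(Ω)` of Borel probability measures on `Ω` with bounded support. -/
structure WassersteinSpaceInfty {d : ℕ} (Ω : Set (EuclideanSpace ℝ (Fin d))) where
  toProb : ProbabilityMeasure Ω
  isBounded_support : Bornology.IsBounded (toProb : Measure Ω).support

/-- `𝒲_∞(Ω)` carries the topology of the distance `W_∞`. -/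
instance {d : ℕ} (Ω : Set (EuclideanSpace ℝ (Fin d))) :
    TopologicalSpace (WassersteinSpaceInfty Ω) :=
  topologyOfEDist fun μ ν => wassersteinInftyEDist μ.toProb ν.toProb

end

open Filter Topology

/-! ### Topologies generated by the balls of a distance function -/

section Topology

/-! The obstructions come from the functionals `μ ↦ ‖f‖_{L^q(μ)}` with `f` 1-Lipschitz: by
Minkowski's inequality on a plan they are 1-Lipschitz for `W_p` when `1 ≤ q ≤ p`. Hence no triangle
inequality for `W_p` is needed. They are tested on `(1 - t) δ_x + t δ_y`. For `W_∞`, as `t → 0` the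
`L^∞` norm of `dist · x` stays at `dist y x` while its `L^1` norm tends to `0`. A compact set
containing these measures would contain one realising both values, which is absurd. If `x` is not
isolated, such measures lie in every ball about `δ_x`. For `p < ∞` and `Ω` unbounded, put mass `(c /
R)^p` at distance `R → ∞` from `x`: the `L^p` norm of `dist · x` is always `c`, that of `min (dist ·
x) 1` is `c / R → 0`, and the same contradiction arises. If `𝒲_p(Ω)` is compact, extreme values of
the `L^p` norm of `dist · z`, compared with Dirac masses, show that `Ω` is closed and bounded.
Conversely, for compact `Ω` the weakly compact space of probability measures maps continuously onto
`𝒲_p(Ω)` (`eventually_wassersteinEDist_lt`). -/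

theorem continuous_topologyOfEDist {X : Type*} {D : X → X → ℝ≥0∞} {G : X → ℝ≥0∞}
    (h₁ : ∀ x y, G x ≤ G y + D x y) (h₂ : ∀ x y, G y ≤ G x + D x y) :
    @Continuous X ℝ≥0∞ (topologyOfEDist D) _ G := by
  let := topologyOfEDist D
  refine continuous_def.2 fun V hV x hx => ?_
  by_cases hGx : G x = ∞
  -- Any finite radius works: points at finite distance from `x` also have value `∞`.
  · refine ⟨1, one_pos, fun y hy => ?_⟩
    have : G y = ∞ := by
      by_contra hne
      exact (ENNReal.add_lt_top.2 ⟨lt_top_iff_ne_top.2 hne, hy.trans ENNReal.one_lt_top⟩).not_ge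
        (hGx ▸ h₁ x y)
    rw [Set.mem_preimage, this, ← hGx]
    exact hx
  · obtain ⟨ε, hε, hsub⟩ := (ENNReal.hasBasis_nhds_of_ne_top hGx).mem_iff.1 (hV.mem_nhds hx)
    refine ⟨ε, hε, fun y hy => hsub ⟨?_, ?_⟩⟩
    · exact tsub_le_iff_right.2 ((h₁ x y).trans (by gcongr))
    · exact (h₂ x y).trans (by gcongr)

theorem exists_ball_subset_of_mem_nhds_topologyOfEDist {X : Type*} {D : X → X → ℝ≥0∞}
    {x : X} {K : Set X} (hK : K ∈ @nhds X (topologyOfEDist D) x) :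
    ∃ ε : ℝ≥0∞, 0 < ε ∧ ∀ y, D x y < ε → y ∈ K := by
  let := topologyOfEDist D
  obtain ⟨U, hUK, hU, hxU⟩ := mem_nhds_iff.1 hK
  obtain ⟨ε, hε, h⟩ := hU x hxU
  exact ⟨ε, hε, fun y hy => hUK (h y hy)⟩

/-- `W` need be neither Hausdorff nor first countable: the limit is taken in `ℝ≥0∞ × ℝ≥0∞`, where
the image of `K` is compact, hence closed. -/
theorem IsCompact.exists_eq_of_tendsto {W : Type*} [TopologicalSpace W] {K : Set W}
    (hK : IsCompact K) {F G : W → ℝ≥0∞} (hF : Continuous F) (hG : Continuous G)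
    {a b : ℝ≥0∞} {u : ℕ → W} (hu : ∀ n, u n ∈ K) (ha : ∀ n, F (u n) = a)
    (hb : Tendsto (fun n => G (u n)) atTop (𝓝 b)) : ∃ w ∈ K, F w = a ∧ G w = b := by
  have hc : IsClosed ((fun w => (F w, G w)) '' K) := (hK.image (hF.prodMk hG)).isClosed
  have ht : Tendsto (fun n => (F (u n), G (u n))) atTop (𝓝 (a, b)) := by
    simp only [ha]
    exact tendsto_const_nhds.prodMk_nhds hb
  obtain ⟨w, hw, hwab⟩ := hc.mem_of_tendsto ht
    (Eventually.of_forall fun n => Set.mem_image_of_mem _ (hu n))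
  exact ⟨w, hw, congrArg Prod.fst hwab, congrArg Prod.snd hwab⟩

end Topology

/-! ### Lipschitz functionals on measures -/

section Plans

variable {X : Type*} [MetricSpace X] [MeasurableSpace X]

theorem wassersteinEDist_eq_iInf_eLpNorm {p : ℝ} (hp : 0 < p) (μ ν : ProbabilityMeasure X) :
    wassersteinEDist p μ ν = ⨅ γ ∈ transportPlans μ ν,
      eLpNorm (fun z : X × X => dist z.1 z.2) (ENNReal.ofReal p) (γ : Measure (X × X)) := by
  have hp' : 0 < 1 / p := one_div_pos.2 hp
  unfold wassersteinEDist
  rw [← ENNReal.orderIsoRpow_apply _ hp', OrderIso.map_iInf₂]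
  refine iInf_congr fun γ => iInf_congr fun _ => ?_
  rw [ENNReal.orderIsoRpow_apply]
  rw [eLpNorm_eq_lintegral_rpow_enorm_toReal (by simpa using hp) ENNReal.ofReal_ne_top,
    ENNReal.toReal_ofReal hp.le]
  simp [edist_dist, Real.enorm_of_nonneg]

theorem wassersteinInftyEDist_eq_iInf_eLpNorm (μ ν : ProbabilityMeasure X) :
    wassersteinInftyEDist μ ν = ⨅ γ ∈ transportPlans μ ν,
      eLpNorm (fun z : X × X => dist z.1 z.2) ∞ (γ : Measure (X × X)) := by
  simp [wassersteinInftyEDist, eLpNormEssSup, edist_dist, Real.enorm_of_nonneg]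

variable [OpensMeasurableSpace X] [SecondCountableTopology X]

/-- Both norms are computed on the plan `γ`, where `|f z.1| ≤ |f z.2| + dist z.1 z.2`. Minkowski
gives the bound with exponent `q`, and `γ` being a probability measure allows passing to `p`. -/
theorem eLpNorm_fst_le_add_of_mem_transportPlans {μ ν : ProbabilityMeasure X}
    {γ : ProbabilityMeasure (X × X)} (hγ : γ ∈ transportPlans μ ν) {f : X → ℝ}
    (hf : LipschitzWith 1 f) {q p : ℝ≥0∞} (hq : 1 ≤ q) (hqp : q ≤ p) :
    eLpNorm f q (μ : Measure X) ≤ eLpNorm f q (ν : Measure X) +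
        eLpNorm (fun z : X × X => dist z.1 z.2) p (γ : Measure (X × X)) ∧
      eLpNorm f q (ν : Measure X) ≤ eLpNorm f q (μ : Measure X) +
        eLpNorm (fun z : X × X => dist z.1 z.2) p (γ : Measure (X × X)) := by
  have hfc : Continuous f := hf.continuous
  have hd : AEStronglyMeasurable (fun z : X × X => dist z.1 z.2) (γ : Measure (X × X)) :=
    continuous_dist.aestronglyMeasurable
  have h₁ : eLpNorm f q (μ : Measure X) = eLpNorm (f ∘ Prod.fst) q (γ : Measure (X × X)) := by
    rw [← hγ.1, eLpNorm_map_measure hfc.aestronglyMeasurable measurable_fst.aemeasurable]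
  have h₂ : eLpNorm f q (ν : Measure X) = eLpNorm (f ∘ Prod.snd) q (γ : Measure (X × X)) := by
    rw [← hγ.2, eLpNorm_map_measure hfc.aestronglyMeasurable measurable_snd.aemeasurable]
  have key : ∀ g h : X × X → ℝ, Continuous g → Continuous h →
      (∀ z, |g z| ≤ |h z| + dist z.1 z.2) →
      eLpNorm g q (γ : Measure (X × X)) ≤ eLpNorm h q (γ : Measure (X × X)) +
        eLpNorm (fun z : X × X => dist z.1 z.2) p (γ : Measure (X × X)) := by
    intro g h hg hh hgh
    calc eLpNorm g q (γ : Measure (X × X))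
        ≤ eLpNorm ((fun z => ‖h z‖) + fun z : X × X => dist z.1 z.2) q
            (γ : Measure (X × X)) := eLpNorm_mono_real hgh
      _ ≤ eLpNorm (fun z => ‖h z‖) q (γ : Measure (X × X)) +
            eLpNorm (fun z : X × X => dist z.1 z.2) q (γ : Measure (X × X)) :=
          eLpNorm_add_le hh.norm.aestronglyMeasurable hd hq
      _ ≤ _ := by
          rw [eLpNorm_norm]
          gcongr
          exact eLpNorm_le_eLpNorm_of_exponent_le hqp hd
  have hL : ∀ z : X × X, |f z.1 - f z.2| ≤ dist z.1 z.2 := fun z => by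
    simpa [Real.dist_eq] using hf.dist_le_mul z.1 z.2
  rw [h₁, h₂]
  constructor
  · refine key _ _ (hfc.comp continuous_fst) (hfc.comp continuous_snd) fun z => ?_
    have := abs_sub_abs_le_abs_sub (f z.1) (f z.2)
    simp only [Function.comp]
    linarith [hL z]
  · refine key _ _ (hfc.comp continuous_snd) (hfc.comp continuous_fst) fun z => ?_
    have := abs_sub_abs_le_abs_sub (f z.2) (f z.1)
    rw [abs_sub_comm] at this
    simp only [Function.comp]
    linarith [hL z]

theorem eLpNorm_le_add_iInf_transportPlans (μ ν : ProbabilityMeasure X) {f : X → ℝ}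
    (hf : LipschitzWith 1 f) {q p : ℝ≥0∞} (hq : 1 ≤ q) (hqp : q ≤ p) :
    eLpNorm f q (μ : Measure X) ≤ eLpNorm f q (ν : Measure X) + ⨅ γ ∈ transportPlans μ ν,
        eLpNorm (fun z : X × X => dist z.1 z.2) p (γ : Measure (X × X)) ∧
      eLpNorm f q (ν : Measure X) ≤ eLpNorm f q (μ : Measure X) + ⨅ γ ∈ transportPlans μ ν,
        eLpNorm (fun z : X × X => dist z.1 z.2) p (γ : Measure (X × X)) := by
  simp only [← tsub_le_iff_left, le_iInf_iff]
  exact ⟨fun γ hγ => tsub_le_iff_left.2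
      (eLpNorm_fst_le_add_of_mem_transportPlans hγ hf hq hqp).1,
    fun γ hγ => tsub_le_iff_left.2 (eLpNorm_fst_le_add_of_mem_transportPlans hγ hf hq hqp).2⟩

end Plans

section Continuity

variable {d : ℕ} {Ω : Set (EuclideanSpace ℝ (Fin d))}

theorem WassersteinSpace.continuous_eLpNorm {p : ℝ} (hp : 1 ≤ p) {f : Ω → ℝ}
    (hf : LipschitzWith 1 f) : Continuous fun μ : WassersteinSpace Ω p =>
      eLpNorm f (ENNReal.ofReal p) (μ.toProb : Measure Ω) := by
  have hp₁ : 1 ≤ ENNReal.ofReal p := by simpa using hp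
  refine continuous_topologyOfEDist (fun μ ν => ?_) fun μ ν => ?_ <;>
    rw [wassersteinEDist_eq_iInf_eLpNorm (by linarith)]
  · exact (eLpNorm_le_add_iInf_transportPlans μ.toProb ν.toProb hf hp₁ le_rfl).1
  · exact (eLpNorm_le_add_iInf_transportPlans μ.toProb ν.toProb hf hp₁ le_rfl).2

theorem WassersteinSpaceInfty.continuous_eLpNorm {q : ℝ≥0∞} (hq : 1 ≤ q) {f : Ω → ℝ}
    (hf : LipschitzWith 1 f) : Continuous fun μ : WassersteinSpaceInfty Ω =>
      eLpNorm f q (μ.toProb : Measure Ω) := by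
  refine continuous_topologyOfEDist (fun μ ν => ?_) fun μ ν => ?_ <;>
    rw [wassersteinInftyEDist_eq_iInf_eLpNorm]
  · exact (eLpNorm_le_add_iInf_transportPlans μ.toProb ν.toProb hf hq le_top).1
  · exact (eLpNorm_le_add_iInf_transportPlans μ.toProb ν.toProb hf hq le_top).2

end Continuity

/-! ### Two-point measures -/

section TwoPoint

variable {X : Type*} [MeasurableSpace X]

/-- The probability measure `(1 - t) δ_x + t δ_y`. -/
noncomputable def twoPointMeasure (x y : X) (t : ℝ≥0∞) (ht : t ≤ 1) : ProbabilityMeasure X :=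
  ⟨(1 - t) • Measure.dirac x + t • Measure.dirac y, ⟨by simp [tsub_add_cancel_of_le ht]⟩⟩

theorem coe_twoPointMeasure (x y : X) {t : ℝ≥0∞} (ht : t ≤ 1) :
    (twoPointMeasure x y t ht : Measure X) = (1 - t) • Measure.dirac x + t • Measure.dirac y :=
  rfl

variable [MeasurableSingletonClass X]

/-- For `p = ∞` the exponent `1 / p.toReal` is `1 / 0 = 0`, so the formula correctly gives `‖f y‖ₑ`;
this is where `t ≠ 0` matters. -/
theorem eLpNorm_twoPointMeasure {x y : X} (hxy : x ≠ y) {t : ℝ≥0∞} (ht : t ≤ 1) (ht₀ : t ≠ 0)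
    {p : ℝ≥0∞} (hp : p ≠ 0) {f : X → ℝ} (hf : f x = 0) :
    eLpNorm f p (twoPointMeasure x y t ht : Measure X) = ‖f y‖ₑ * t ^ (1 / p.toReal) := by
  have hy : (twoPointMeasure x y t ht : Measure X) {y} = t := by
    simp [coe_twoPointMeasure, hxy]
  have hae : f =ᵐ[(twoPointMeasure x y t ht : Measure X)] Set.indicator {y} fun _ => f y := by
    rw [coe_twoPointMeasure]
    refine (ae_add_measure_iff.2 ⟨?_, ?_⟩ :
      ∀ᵐ z ∂(_ + _ : Measure X), f z = Set.indicator {y} (fun _ => f y) z)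
    · refine Measure.ae_smul_measure ?_ _
      rw [ae_dirac_eq, eventually_pure]
      simp [hxy, hf]
    · refine Measure.ae_smul_measure ?_ _
      rw [ae_dirac_eq, eventually_pure]
      simp
  rw [eLpNorm_congr_ae hae, eLpNorm_indicator_const' (MeasurableSet.singleton y) (by rwa [hy]) hp,
    hy]

theorem lintegral_twoPointMeasure_lt_top (x y : X) {t : ℝ≥0∞} (ht : t ≤ 1) {g : X → ℝ≥0∞}
    (hg : ∀ z, g z < ∞) : ∫⁻ z, g z ∂(twoPointMeasure x y t ht : Measure X) < ∞ := by
  rw [coe_twoPointMeasure]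
  simp only [lintegral_add_measure, lintegral_smul_measure, lintegral_dirac, smul_eq_mul]
  exact ENNReal.add_lt_top.2 ⟨ENNReal.mul_lt_top (tsub_le_self.trans_lt ENNReal.one_lt_top) (hg x),
    ENNReal.mul_lt_top (ht.trans_lt ENNReal.one_lt_top) (hg y)⟩

end TwoPoint

section TwoPointMetric

variable {X : Type*} [MetricSpace X] [MeasurableSpace X] [OpensMeasurableSpace X]
  [SecondCountableTopology X]

theorem iInf_transportPlans_dirac_twoPointMeasure_le {x y : X} (hxy : x ≠ y) {t : ℝ≥0∞}
    (ht : t ≤ 1) (ht₀ : t ≠ 0) {p : ℝ≥0∞} (hp : p ≠ 0) :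
    ⨅ γ ∈ transportPlans (twoPointMeasure x x 0 zero_le_one) (twoPointMeasure x y t ht),
      eLpNorm (fun z : X × X => dist z.1 z.2) p (γ : Measure (X × X)) ≤
      edist x y * t ^ (1 / p.toReal) := by
  have hm : Measurable fun z : X => (x, z) := measurable_prodMk_left
  -- The plan is the product of `δ_x` with the two-point measure.
  refine (iInf₂_le ((twoPointMeasure x y t ht).map hm.aemeasurable) ⟨?_, ?_⟩).trans
    (le_of_eq ?_)
  rotate_left 1
  · rw [ProbabilityMeasure.toMeasure_map, Measure.map_map measurable_fst hm]
    have : Prod.fst ∘ (fun z : X => (x, z)) = fun _ => x := rfl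
    rw [this, Measure.map_const]
    simp [coe_twoPointMeasure, tsub_add_cancel_of_le ht]
  · rw [ProbabilityMeasure.toMeasure_map, Measure.map_map measurable_snd hm]
    exact Measure.map_id
  · rw [ProbabilityMeasure.toMeasure_map, eLpNorm_map_measure
      continuous_dist.aestronglyMeasurable hm.aemeasurable,
      eLpNorm_twoPointMeasure hxy ht ht₀ hp (by simp)]
    simp [edist_dist, Real.enorm_of_nonneg]

theorem isBounded_support_twoPointMeasure (x y : X) {t : ℝ≥0∞} (ht : t ≤ 1) :
    Bornology.IsBounded (twoPointMeasure x y t ht : Measure X).support := by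
  refine (Set.toFinite {x, y}).isBounded.subset
    (Measure.support_subset_of_isClosed (Set.toFinite {x, y}).isClosed ?_)
  rw [mem_ae_iff]
  simp [coe_twoPointMeasure]

end TwoPointMetric

/-! ### Failure of compactness, and compactness of the base -/

section NotCompact

variable {d : ℕ} {Ω : Set (EuclideanSpace ℝ (Fin d))}

theorem lipschitzWith_one_dist_coe (z : EuclideanSpace ℝ (Fin d)) :
    LipschitzWith 1 fun x : Ω => dist (x : EuclideanSpace ℝ (Fin d)) z := by
  simpa [Function.comp_def] using
    (LipschitzWith.dist_left z).comp (LipschitzWith.subtype_val Ω)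

/-- The two-point measure as an element of `𝒲_p(Ω)`. -/
noncomputable def WassersteinSpace.twoPoint {p : ℝ} (hp : 0 ≤ p) (x y : Ω) (t : ℝ≥0∞)
    (ht : t ≤ 1) : WassersteinSpace Ω p :=
  ⟨twoPointMeasure x y t ht, lintegral_twoPointMeasure_lt_top x y ht fun _ =>
    ENNReal.rpow_lt_top_of_nonneg hp enorm_ne_top⟩

/-- The two-point measure as an element of `𝒲_∞(Ω)`. -/
noncomputable def WassersteinSpaceInfty.twoPoint (x y : Ω) (t : ℝ≥0∞) (ht : t ≤ 1) :
    WassersteinSpaceInfty Ω :=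
  ⟨twoPointMeasure x y t ht, isBounded_support_twoPointMeasure x y ht⟩

theorem WassersteinSpaceInfty.not_forall_twoPoint_mem_of_isCompact
    {K : Set (WassersteinSpaceInfty Ω)} (hK : IsCompact K) {x y : Ω} (hxy : x ≠ y)
    (h : ∀ (t : ℝ≥0∞) (ht : t ≤ 1), t ≠ 0 → twoPoint x y t ht ∈ K) : False := by
  have hL := lipschitzWith_one_dist_coe (Ω := Ω) (x : EuclideanSpace ℝ (Fin d))
  have hle : ∀ n : ℕ, ((n : ℝ≥0∞) + 1)⁻¹ ≤ 1 := fun n => by simp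
  have hne : ∀ n : ℕ, ((n : ℝ≥0∞) + 1)⁻¹ ≠ 0 := fun n => by simp
  have hlim : Tendsto (fun n : ℕ => ((n : ℝ≥0∞) + 1)⁻¹) atTop (𝓝 0) := by
    simpa using (tendsto_add_atTop_iff_nat 1).2 ENNReal.tendsto_inv_nat_nhds_zero
  have hy : ‖dist (y : EuclideanSpace ℝ (Fin d)) x‖ₑ ≠ 0 := by
    simpa [enorm_eq_zero, dist_eq_zero, Subtype.ext_iff] using fun h => hxy (Subtype.ext h.symm)
  obtain ⟨ν, -, hν, hν'⟩ := hK.exists_eq_of_tendsto (continuous_eLpNorm (q := ∞) le_top hL)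
    (continuous_eLpNorm (q := 1) le_rfl hL)
    (u := fun n : ℕ => twoPoint x y ((n : ℝ≥0∞) + 1)⁻¹ (hle n)) (fun n => h _ _ (hne n))
    (a := ‖dist (y : EuclideanSpace ℝ (Fin d)) x‖ₑ) (b := 0)
    (fun n => by
      rw [twoPoint, eLpNorm_twoPointMeasure hxy (hle n) (hne n) (by simp) (by simp)]
      simp)
    (by
      have : ∀ n : ℕ, eLpNorm (fun z : Ω => dist (z : EuclideanSpace ℝ (Fin d)) x) 1
          ((twoPoint x y ((n : ℝ≥0∞) + 1)⁻¹ (hle n)).toProb : Measure Ω) =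
          ‖dist (y : EuclideanSpace ℝ (Fin d)) x‖ₑ * ((n : ℝ≥0∞) + 1)⁻¹ := fun n => by
        rw [twoPoint, eLpNorm_twoPointMeasure hxy (hle n) (hne n) (by simp) (by simp)]
        simp
      simp only [this]
      simpa using ENNReal.Tendsto.const_mul hlim (Or.inr enorm_ne_top))
  rw [eLpNorm_eq_zero_iff hL.continuous.aestronglyMeasurable one_ne_zero] at hν'
  rw [eLpNorm_congr_ae hν', eLpNorm_zero] at hν
  exact hy hν.symm

theorem WassersteinSpaceInfty.not_compactSpace (hΩ : Ω.Nontrivial) :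
    ¬ CompactSpace (WassersteinSpaceInfty Ω) := by
  intro h
  obtain ⟨x, hx, y, hy, hxy⟩ := hΩ
  exact not_forall_twoPoint_mem_of_isCompact isCompact_univ (x := ⟨x, hx⟩) (y := ⟨y, hy⟩)
    (by simpa using hxy) fun _ _ _ => Set.mem_univ _

theorem WassersteinSpaceInfty.not_weaklyLocallyCompactSpace (hΩ : ¬ DiscreteTopology Ω) :
    ¬ WeaklyLocallyCompactSpace (WassersteinSpaceInfty Ω) := by
  intro h
  refine hΩ (discreteTopology_iff_isOpen_singleton.2 fun x => ?_)
  obtain ⟨K, hK, hKx⟩ := exists_compact_mem_nhds (twoPoint x x 0 zero_le_one)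
  obtain ⟨ε, hε, hεK⟩ := exists_ball_subset_of_mem_nhds_topologyOfEDist hKx
  refine EMetric.isOpen_iff.2 ?_
  rintro _ rfl
  refine ⟨ε, hε, fun y hy => ?_⟩
  -- A point `y ≠ x` of the `ε`-ball would put all two-point measures on `x, y` in `K`, whatever `t`
  -- is.
  by_contra hne
  refine not_forall_twoPoint_mem_of_isCompact hK (Ne.symm hne) fun t ht ht₀ => hεK _ ?_
  rw [wassersteinInftyEDist_eq_iInf_eLpNorm]
  refine (iInf_transportPlans_dirac_twoPointMeasure_le (Ne.symm hne) ht ht₀ (by simp)).trans_lt ?_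
  simpa [edist_comm] using hy

theorem WassersteinSpace.not_weaklyLocallyCompactSpace {p : ℝ} (hp : 1 ≤ p)
    (hΩ : ¬ Bornology.IsBounded Ω) : ¬ WeaklyLocallyCompactSpace (WassersteinSpace Ω p) := by
  intro h
  have hp₀ : 0 < p := by linarith
  have hp' : ENNReal.ofReal p ≠ 0 := by simpa using hp₀
  obtain ⟨x, hx⟩ : Ω.Nonempty := by
    by_contra hne
    exact hΩ (by simp [Set.not_nonempty_iff_eq_empty.1 hne])
  lift x to Ω using hx
  obtain ⟨K, hK, hKx⟩ := exists_compact_mem_nhds (twoPoint hp₀.le x x 0 zero_le_one)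
  obtain ⟨ε, hε, hεK⟩ := exists_ball_subset_of_mem_nhds_topologyOfEDist hKx
  -- `c < ε` keeps the test measures in `K`; `c < 1 ≤ R n` makes `(c / R n) ^ p` an admissible mass.
  obtain ⟨c, hc₀, hc⟩ := exists_between (lt_min hε one_pos)
  obtain ⟨hcε, hc₁⟩ := lt_min_iff.1 hc
  have hfar : ∀ n : ℕ, ∃ y : Ω, (n : ℝ) + 1 < dist (y : EuclideanSpace ℝ (Fin d)) x := by
    intro n
    by_contra! hy
    exact hΩ ((Metric.isBounded_iff_subset_closedBall (x : EuclideanSpace ℝ (Fin d))).2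
      ⟨n + 1, fun y hyΩ => hy ⟨y, hyΩ⟩⟩)
  choose y hy using hfar
  have hy₁ : ∀ n, 1 ≤ dist (y n : EuclideanSpace ℝ (Fin d)) x := fun n =>
    le_trans (by linarith [n.cast_nonneg (α := ℝ)]) (hy n).le
  have hxy : ∀ n, x ≠ y n := fun n he => by
    have := hy₁ n
    rw [← he, dist_self] at this
    linarith
  set R : ℕ → ℝ≥0∞ := fun n => edist (y n : EuclideanSpace ℝ (Fin d)) x with hR
  have hRn : ∀ n : ℕ, ((n + 1 : ℕ) : ℝ≥0∞) ≤ R n := fun n => by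
    simp only [hR]
    rw [edist_dist, ← ENNReal.ofReal_natCast]
    exact ENNReal.ofReal_le_ofReal (by simpa using (hy n).le)
  have hR₁ : ∀ n, 1 ≤ R n := fun n => le_trans (by simp) (hRn n)
  have hR_top : ∀ n, R n ≠ ∞ := fun n => edist_ne_top _ _
  have hR₀ : ∀ n, R n ≠ 0 := fun n => (one_pos.trans_le (hR₁ n)).ne'
  have ht : ∀ n, (c / R n) ^ p ≤ 1 := fun n =>
    ENNReal.rpow_le_one (ENNReal.div_le_of_le_mul (hc₁.le.trans (by simpa using hR₁ n))) hp₀.le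
  have ht₀ : ∀ n, (c / R n) ^ p ≠ 0 := fun n =>
    (ENNReal.rpow_pos (ENNReal.div_pos hc₀.ne' (hR_top n))
      (ENNReal.div_ne_top hc₁.ne_top (hR₀ n))).ne'
  have hroot : ∀ n, ((c / R n) ^ p) ^ (1 / (ENNReal.ofReal p).toReal) = c / R n := fun n => by
    rw [ENNReal.toReal_ofReal hp₀.le, ← ENNReal.rpow_mul, mul_one_div_cancel hp₀.ne',
      ENNReal.rpow_one]
  have hRc : ∀ n, R n * (c / R n) = c := fun n => ENNReal.mul_div_cancel (hR₀ n) (hR_top n)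
  have hRe : ∀ n, ‖dist (y n : EuclideanSpace ℝ (Fin d)) x‖ₑ = R n := fun n => by
    rw [Real.enorm_of_nonneg dist_nonneg, ← edist_dist]
  have hL := lipschitzWith_one_dist_coe (Ω := Ω) (x : EuclideanSpace ℝ (Fin d))
  have hL' : LipschitzWith 1 fun z : Ω => min (dist (z : EuclideanSpace ℝ (Fin d)) x) 1 :=
    hL.min_const 1
  obtain ⟨ν, -, hν, hν'⟩ := hK.exists_eq_of_tendsto (continuous_eLpNorm hp hL)
    (continuous_eLpNorm hp hL')
    (u := fun n : ℕ => twoPoint hp₀.le x (y n) ((c / R n) ^ p) (ht n)) (a := c) (b := 0)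
    (fun n => hεK _ (by
      rw [wassersteinEDist_eq_iInf_eLpNorm hp₀]
      refine (iInf_transportPlans_dirac_twoPointMeasure_le (hxy n) (ht n) (ht₀ n) hp').trans_lt ?_
      rw [hroot, edist_comm, Subtype.edist_eq, hRc]
      exact hcε))
    (fun n => by
      rw [twoPoint, eLpNorm_twoPointMeasure (hxy n) (ht n) (ht₀ n) hp' (by simp), hroot, hRe, hRc])
    (by
      have : ∀ n : ℕ, eLpNorm (fun z : Ω => min (dist (z : EuclideanSpace ℝ (Fin d)) x) 1)
          (ENNReal.ofReal p)
          ((twoPoint hp₀.le x (y n) ((c / R n) ^ p) (ht n)).toProb : Measure Ω) = c / R n :=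
        fun n => by
          rw [twoPoint, eLpNorm_twoPointMeasure (hxy n) (ht n) (ht₀ n) hp' (by simp), hroot,
            min_eq_right (hy₁ n)]
          simp
      simp only [this]
      refine tendsto_of_tendsto_of_tendsto_of_le_of_le tendsto_const_nhds
        ((tendsto_add_atTop_iff_nat 1).2 ENNReal.tendsto_inv_nat_nhds_zero)
        (fun _ => zero_le) fun n => ?_
      calc c / R n ≤ 1 / R n := by gcongr
        _ ≤ _ := by rw [one_div]; exact ENNReal.inv_le_inv.2 (hRn n))
  rw [eLpNorm_eq_zero_iff hL'.continuous.aestronglyMeasurable hp'] at hν'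
  -- The truncated distance vanishes only where the distance does, so `ν` has norm `0` instead of
  -- `c`.
  have hae : (fun z : Ω => dist (z : EuclideanSpace ℝ (Fin d)) x)
      =ᵐ[(ν.toProb : Measure Ω)] 0 := by
    filter_upwards [hν'] with z hz
    rcases min_choice (dist (z : EuclideanSpace ℝ (Fin d)) x) 1 with h | h <;>
      simp only [h, Pi.zero_apply] at hz ⊢
    · exact hz
    · exact absurd hz one_ne_zero
  rw [eLpNorm_congr_ae hae, eLpNorm_zero] at hν
  exact hc₀.ne hν

theorem WassersteinSpace.isCompact_of_compactSpace {p : ℝ} (hp : 1 ≤ p)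
    [CompactSpace (WassersteinSpace Ω p)] : IsCompact Ω := by
  rcases Ω.eq_empty_or_nonempty with rfl | ⟨x, hx⟩
  · exact isCompact_empty
  lift x to Ω using hx
  have hp₀ : 0 < p := by linarith
  have hp' : ENNReal.ofReal p ≠ 0 := by simpa using hp₀
  have hdirac : ∀ (y : Ω) (z : EuclideanSpace ℝ (Fin d)),
      eLpNorm (fun w : Ω => dist (w : EuclideanSpace ℝ (Fin d)) z) (ENNReal.ofReal p)
        ((twoPoint hp₀.le y y 0 zero_le_one).toProb : Measure Ω) =
        edist (y : EuclideanSpace ℝ (Fin d)) z := by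
    intro y z
    rw [twoPoint, coe_twoPointMeasure]
    simp only [tsub_zero, one_smul, zero_smul, add_zero]
    rw [eLpNorm_dirac _ _ hp', edist_dist, Real.enorm_of_nonneg dist_nonneg]
  have : Nonempty (WassersteinSpace Ω p) := ⟨twoPoint hp₀.le x x 0 zero_le_one⟩
  refine Metric.isCompact_of_isClosed_isBounded (isClosed_of_closure_subset fun z hz => ?_) ?_
  · have hL := lipschitzWith_one_dist_coe (Ω := Ω) z
    -- Dirac masses at points of `Ω` near `z` force the minimum to be `0`, so `ν` is concentrated at
    -- `z`, which thus lies in `Ω`.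
    obtain ⟨ν, -, hν⟩ := isCompact_univ.exists_isMinOn Set.univ_nonempty
      (continuous_eLpNorm hp hL).continuousOn
    have h0 : eLpNorm (fun w : Ω => dist (w : EuclideanSpace ℝ (Fin d)) z) (ENNReal.ofReal p)
        (ν.toProb : Measure Ω) = 0 := by
      refine le_antisymm (le_of_forall_gt fun ε hε => ?_) zero_le
      obtain ⟨y, hy, hyz⟩ := EMetric.mem_closure_iff.1 hz ε hε
      refine (hν (Set.mem_univ (twoPoint hp₀.le ⟨y, hy⟩ ⟨y, hy⟩ 0 zero_le_one))).trans_lt ?_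
      simp only [hdirac]
      rwa [edist_comm]
    rw [eLpNorm_eq_zero_iff hL.continuous.aestronglyMeasurable hp'] at h0
    obtain ⟨w, hw⟩ := h0.exists
    have : (w : EuclideanSpace ℝ (Fin d)) = z := dist_eq_zero.1 hw
    exact this ▸ w.2
  · have hL := lipschitzWith_one_dist_coe (Ω := Ω) (x : EuclideanSpace ℝ (Fin d))
    obtain ⟨ν, -, hν⟩ := isCompact_univ.exists_isMaxOn Set.univ_nonempty
      (continuous_eLpNorm hp hL).continuousOn
    -- The maximum is finite by the moment condition, and it bounds the distance from `x` to each
    -- point, through its Dirac mass.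
    have hfin : eLpNorm (fun w : Ω => dist (w : EuclideanSpace ℝ (Fin d)) x) (ENNReal.ofReal p)
        (ν.toProb : Measure Ω) ≠ ∞ := by
      have h₁ : MemLp (fun w : Ω => ‖(w : EuclideanSpace ℝ (Fin d))‖) (ENNReal.ofReal p)
          (ν.toProb : Measure Ω) := by
        refine ⟨continuous_subtype_val.norm.aestronglyMeasurable, ?_⟩
        rw [eLpNorm_norm, eLpNorm_lt_top_iff_lintegral_rpow_enorm_lt_top hp' ENNReal.ofReal_ne_top,
          ENNReal.toReal_ofReal hp₀.le]
        exact ν.moment_lt_top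
      refine ((h₁.add (memLp_const ‖(x : EuclideanSpace ℝ (Fin d))‖)).mono
        hL.continuous.aestronglyMeasurable (Eventually.of_forall fun w => ?_)).eLpNorm_ne_top
      simp only [Pi.add_apply]
      rw [Real.norm_of_nonneg dist_nonneg, Real.norm_of_nonneg (by positivity), dist_eq_norm]
      exact norm_sub_le _ _
    refine (Metric.isBounded_iff_subset_closedBall (x : EuclideanSpace ℝ (Fin d))).2
      ⟨(eLpNorm (fun w : Ω => dist (w : EuclideanSpace ℝ (Fin d)) x) (ENNReal.ofReal p)
        (ν.toProb : Measure Ω)).toReal, fun y hy => ?_⟩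
    · have := hν (Set.mem_univ (twoPoint hp₀.le ⟨y, hy⟩ ⟨y, hy⟩ 0 zero_le_one))
      simp only [Set.mem_ofPred_eq, hdirac] at this
      rw [edist_dist] at this
      exact (ENNReal.ofReal_le_iff_le_toReal hfin).1 this

end NotCompact

/-! ### Gluing plans over a decomposition of the measures -/

section Coupling

variable {X : Type*} [MeasurableSpace X]

theorem exists_measure_prod_map_eq (α β : Measure X) [IsFiniteMeasure α] [IsFiniteMeasure β]
    (h : α Set.univ = β Set.univ) :
    ∃ γ : Measure (X × X), γ.map Prod.fst = α ∧ γ.map Prod.snd = β := by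
  by_cases h0 : α Set.univ = 0
  · have hα : α = 0 := Measure.measure_univ_eq_zero.1 h0
    have hβ : β = 0 := Measure.measure_univ_eq_zero.1 (h ▸ h0)
    exact ⟨0, by simp [hα], by simp [hβ]⟩
  · refine ⟨(α Set.univ)⁻¹ • α.prod β, ?_, ?_⟩
    · rw [Measure.map_smul, Measure.map_fst_prod, smul_smul, ← h,
        ENNReal.inv_mul_cancel h0 (measure_ne_top α _), one_smul]
    · rw [Measure.map_smul, Measure.map_snd_prod, smul_smul,
        ENNReal.inv_mul_cancel h0 (measure_ne_top α _), one_smul]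

theorem ENNReal.exists_le_one_mul_eq {m c : ℝ≥0∞} (hm : m ≠ ∞) (hc : c ≤ m) :
    ∃ a ≤ 1, a * m = c := by
  by_cases h0 : m = 0
  · subst h0
    exact ⟨1, le_rfl, by simpa using hc.antisymm' zero_le⟩
  · exact ⟨c / m, ENNReal.div_le_of_le_mul (by simpa using hc), ENNReal.div_mul_cancel h0 hm⟩

theorem measure_univ_eq_of_map_fst_eq {γ : Measure (X × X)} {α : Measure X}
    (h : γ.map Prod.fst = α) : γ Set.univ = α Set.univ := by
  rw [← h, Measure.map_apply measurable_fst MeasurableSet.univ, Set.preimage_univ]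

/-- In each piece the common mass `min (μ' i univ) (ν' i univ)` is moved inside `S i`, at cost at
most `δ ^ p` per unit. The leftovers have equal total mass and are coupled arbitrarily, at cost at
most `D ^ p` per unit. -/
theorem exists_mem_transportPlans_lintegral_le [PseudoEMetricSpace X] {ι : Type*} [Fintype ι]
    {μ ν : ProbabilityMeasure X} {μ' ν' : ι → Measure X} (hμ : ∑ i, μ' i = (μ : Measure X))
    (hν : ∑ i, ν' i = (ν : Measure X)) {S : ι → Set X} (hμS : ∀ i, ∀ᵐ x ∂μ' i, x ∈ S i)
    (hνS : ∀ i, ∀ᵐ x ∂ν' i, x ∈ S i) {δ D : ℝ≥0∞}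
    (hδ : ∀ i, ∀ x ∈ S i, ∀ y ∈ S i, edist x y ≤ δ) (hD : ∀ x y : X, edist x y ≤ D)
    {p : ℝ} (hp : 0 ≤ p) :
    ∃ γ ∈ transportPlans μ ν, ∫⁻ z, edist z.1 z.2 ^ p ∂(γ : Measure (X × X)) ≤
      δ ^ p + D ^ p * ∑ i, (μ' i Set.univ - ν' i Set.univ) := by
  have hμ₁ : ∑ i, μ' i Set.univ = 1 := by
    rw [← Measure.finsetSum_apply, hμ, measure_univ]
  have hν₁ : ∑ i, ν' i Set.univ = 1 := by
    rw [← Measure.finsetSum_apply, hν, measure_univ]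
  have hμ_top : ∀ i, μ' i Set.univ ≠ ∞ := fun i =>
    ((Finset.single_le_sum (f := fun i => μ' i Set.univ) (fun _ _ => zero_le)
      (Finset.mem_univ i)).trans_lt (hμ₁ ▸ ENNReal.one_lt_top)).ne
  have hν_top : ∀ i, ν' i Set.univ ≠ ∞ := fun i =>
    ((Finset.single_le_sum (f := fun i => ν' i Set.univ) (fun _ _ => zero_le)
      (Finset.mem_univ i)).trans_lt (hν₁ ▸ ENNReal.one_lt_top)).ne
  have : ∀ i, IsFiniteMeasure (μ' i) := fun i => ⟨lt_top_iff_ne_top.2 (hμ_top i)⟩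
  have : ∀ i, IsFiniteMeasure (ν' i) := fun i => ⟨lt_top_iff_ne_top.2 (hν_top i)⟩
  set c : ι → ℝ≥0∞ := fun i => min (μ' i Set.univ) (ν' i Set.univ)
  have hc_top : ∀ i, c i ≠ ∞ := fun i => ((min_le_left _ _).trans_lt
    (lt_top_iff_ne_top.2 (hμ_top i))).ne
  choose a ha hac using fun i => ENNReal.exists_le_one_mul_eq (hμ_top i) (min_le_left _ _ : c i ≤ _)
  choose b hb hbc using fun i => ENNReal.exists_le_one_mul_eq (hν_top i) (min_le_right _ _ : c i ≤ _)
  have hfin : ∀ (u : ℝ≥0∞) (_ : u ≤ 1) (m : Measure X) [IsFiniteMeasure m],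
      IsFiniteMeasure (u • m) := fun u hu m _ =>
    Measure.smul_finite m (hu.trans_lt ENNReal.one_lt_top).ne
  have := fun i => hfin (a i) (ha i) (μ' i)
  have := fun i => hfin (b i) (hb i) (ν' i)
  have := fun i => hfin (1 - a i) tsub_le_self (μ' i)
  have := fun i => hfin (1 - b i) tsub_le_self (ν' i)
  have hasum : ∀ i, (1 - a i) * μ' i Set.univ + c i = μ' i Set.univ := fun i => by
    rw [← show a i * _ = c i from hac i, ← add_mul, tsub_add_cancel_of_le (ha i), one_mul]
  have hbsum : ∀ i, (1 - b i) * ν' i Set.univ + c i = ν' i Set.univ := fun i => by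
    rw [← show b i * _ = c i from hbc i, ← add_mul, tsub_add_cancel_of_le (hb i), one_mul]
  have hrest : (∑ i, (1 - a i) • μ' i) Set.univ = (∑ i, (1 - b i) • ν' i) Set.univ := by
    simp only [Measure.finsetSum_apply, Measure.smul_apply, smul_eq_mul]
    refine (ENNReal.add_left_inj (ENNReal.sum_ne_top.2 fun i _ => hc_top i :
      ∑ i, c i ≠ ∞)).1 ?_
    rw [← Finset.sum_add_distrib, ← Finset.sum_add_distrib]
    simp only [hasum, hbsum, hμ₁, hν₁]
  choose g hg₁ hg₂ using fun i => exists_measure_prod_map_eq (a i • μ' i) (b i • ν' i)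
    (by simp only [Measure.smul_apply, smul_eq_mul, hac, hbc])
  obtain ⟨g', hg'₁, hg'₂⟩ := exists_measure_prod_map_eq _ _ hrest
  have hfst : (∑ i, g i + g').map Prod.fst = (μ : Measure X) := by
    rw [Measure.map_add _ _ measurable_fst, Measure.map_finset_sum measurable_fst.aemeasurable, hg'₁]
    simp only [hg₁]
    rw [← Finset.sum_add_distrib, ← hμ]
    refine Finset.sum_congr rfl fun i _ => ?_
    rw [← add_smul, add_tsub_cancel_of_le (ha i), one_smul]
  have hsnd : (∑ i, g i + g').map Prod.snd = (ν : Measure X) := by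
    rw [Measure.map_add _ _ measurable_snd, Measure.map_finset_sum measurable_snd.aemeasurable, hg'₂]
    simp only [hg₂]
    rw [← Finset.sum_add_distrib, ← hν]
    refine Finset.sum_congr rfl fun i _ => ?_
    rw [← add_smul, add_tsub_cancel_of_le (hb i), one_smul]
  refine ⟨⟨∑ i, g i + g', ⟨by rw [measure_univ_eq_of_map_fst_eq hfst, measure_univ]⟩⟩,
    ⟨hfst, hsnd⟩, ?_⟩
  rw [ProbabilityMeasure.coe_mk, lintegral_add_measure, lintegral_finsetSum_measure]
  gcongr
  · calc ∑ i, ∫⁻ z, edist z.1 z.2 ^ p ∂g i ≤ ∑ i, δ ^ p * c i := by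
          refine Finset.sum_le_sum fun i _ => ?_
          have h₁ : ∀ᵐ z ∂g i, z.1 ∈ S i := ae_of_ae_map measurable_fst.aemeasurable
            (by rw [hg₁]; exact Measure.ae_smul_measure (hμS i) _)
          have h₂ : ∀ᵐ z ∂g i, z.2 ∈ S i := ae_of_ae_map measurable_snd.aemeasurable
            (by rw [hg₂]; exact Measure.ae_smul_measure (hνS i) _)
          calc ∫⁻ z, edist z.1 z.2 ^ p ∂g i ≤ ∫⁻ _, δ ^ p ∂g i := by
                refine lintegral_mono_ae ?_
                filter_upwards [h₁, h₂] with z hz₁ hz₂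
                exact ENNReal.rpow_le_rpow (hδ i _ hz₁ _ hz₂) hp
            _ = δ ^ p * c i := by
                rw [lintegral_const, measure_univ_eq_of_map_fst_eq (hg₁ i), Measure.smul_apply,
                  smul_eq_mul, hac]
      _ = δ ^ p * ∑ i, c i := by rw [Finset.mul_sum]
      _ ≤ δ ^ p * 1 := by
          gcongr
          exact (Finset.sum_le_sum fun i _ => min_le_left _ _).trans hμ₁.le
      _ = δ ^ p := mul_one _
  · calc ∫⁻ z, edist z.1 z.2 ^ p ∂g' ≤ ∫⁻ _, D ^ p ∂g' :=
          lintegral_mono fun z => ENNReal.rpow_le_rpow (hD _ _) hp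
      _ = D ^ p * ∑ i, (1 - a i) * μ' i Set.univ := by
          rw [lintegral_const, measure_univ_eq_of_map_fst_eq hg'₁]
          simp only [Measure.finsetSum_apply, Measure.smul_apply, smul_eq_mul]
      _ = D ^ p * ∑ i, (μ' i Set.univ - ν' i Set.univ) := by
          congr 1
          refine Finset.sum_congr rfl fun i _ => ?_
          rw [ENNReal.eq_sub_of_add_eq (hc_top i) (hasum i), tsub_min]

end Coupling

/-! ### Weak convergence controls the distance on compact sets -/

section Compact

/-- Tent functions on a finite `δ`-net, divided by their sum, which the net keeps positive. -/
theorem exists_partition_continuous_nnreal (X : Type*) [PseudoMetricSpace X] [CompactSpace X]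
    {δ : ℝ} (hδ : 0 < δ) :
    ∃ (t : Finset X) (φ : t → C(X, NNReal)), (∀ x, ∑ i, φ i x = 1) ∧
      ∀ i x, φ i x ≠ 0 → dist x i < δ := by
  obtain ⟨t, htf, ht⟩ :=
    Metric.totallyBounded_iff.1 (isCompact_univ (X := X)).totallyBounded δ hδ
  lift t to Finset X using htf
  set ψ : t → X → NNReal := fun i x => (δ - dist x i).toNNReal
  have hψ : ∀ i, Continuous (ψ i) := fun i => by fun_prop
  have hpos : ∀ x, ∑ i, ψ i x ≠ 0 := fun x h => by
    obtain ⟨i, hi, hx⟩ := Set.mem_iUnion₂.1 (ht (Set.mem_univ x))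
    have := Finset.sum_eq_zero_iff.1 h ⟨i, hi⟩ (Finset.mem_univ _)
    simp only [ψ, Real.toNNReal_eq_zero] at this
    rw [Metric.mem_ball] at hx
    linarith
  refine ⟨t, fun i => ⟨fun x => ψ i x / ∑ j, ψ j x,
    (hψ i).div (continuous_finsetSum _ fun j _ => hψ j) hpos⟩, fun x => ?_, fun i x hx => ?_⟩
  · simp only [ContinuousMap.coe_mk]
    rw [← Finset.sum_div, div_self (hpos x)]
  · by_contra! h
    refine hx ?_
    have : ψ i x = 0 := Real.toNNReal_eq_zero.2 (by linarith)
    simp [this]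

/-- Measures are cut by a continuous partition of unity, not by sets, so the mass of each piece is
weakly continuous in `ν`. The leftover mass then tends to `0`, and the cost bound tends to `δ ^ p <
ε ^ p`. -/
theorem eventually_wassersteinEDist_lt {X : Type*} [MetricSpace X] [CompactSpace X]
    [MeasurableSpace X] [BorelSpace X] {p : ℝ} (hp : 0 < p) (μ : ProbabilityMeasure X)
    {ε : ℝ≥0∞} (hε : 0 < ε) : ∀ᶠ ν in 𝓝 μ, wassersteinEDist p μ ν < ε := by
  obtain ⟨δ, hδ₀, hδ⟩ := ENNReal.lt_iff_exists_nnreal_btwn.1 hε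
  have hδ₀' : (0 : ℝ) < δ := by exact_mod_cast hδ₀
  obtain ⟨t, φ, hφ, hφδ⟩ := exists_partition_continuous_nnreal X (half_pos hδ₀')
  let m : t → ProbabilityMeasure X → Measure X := fun i ν =>
    (ν : Measure X).withDensity fun x => (φ i x : ℝ≥0∞)
  have hφm : ∀ i, Measurable fun x => (φ i x : ℝ≥0∞) := fun i =>
    (φ i).continuous.measurable.coe_nnreal_ennreal
  have hm : ∀ ν, ∑ i, m i ν = (ν : Measure X) := fun ν => by
    ext s hs
    rw [Measure.finsetSum_apply]
    simp only [m, withDensity_apply _ hs]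
    rw [← lintegral_finsetSum _ fun i _ => hφm i]
    have : ∀ x, ∑ i, (φ i x : ℝ≥0∞) = 1 := fun x => by exact_mod_cast hφ x
    simp only [this, lintegral_one, Measure.restrict_apply_univ]
  have hmS : ∀ (i : t) ν, ∀ᵐ x ∂m i ν, x ∈ Metric.ball (i : X) (δ / 2) := fun i ν => by
    refine (ae_withDensity_iff (hφm i)).2 (Eventually.of_forall fun x hx => ?_)
    exact hφδ i x (by simpa using hx)
  have hball : ∀ i : t, ∀ x ∈ Metric.ball (i : X) (δ / 2), ∀ y ∈ Metric.ball (i : X) (δ / 2),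
      edist x y ≤ δ := fun i x hx y hy => by
    rw [edist_le_coe, ← NNReal.coe_le_coe, coe_nndist]
    have := dist_triangle_right x y i
    rw [Metric.mem_ball] at hx hy
    linarith
  have hD : ∀ x y : X, edist x y ≤ ENNReal.ofReal (Metric.diam (Set.univ : Set X)) := fun x y => by
    rw [edist_dist]
    exact ENNReal.ofReal_le_ofReal
      (Metric.dist_le_diam_of_mem isCompact_univ.isBounded (Set.mem_univ x) (Set.mem_univ y))
  have hlim : Tendsto (fun ν => (δ : ℝ≥0∞) ^ p +
      ENNReal.ofReal (Metric.diam (Set.univ : Set X)) ^ p *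
        ∑ i, (m i μ Set.univ - m i ν Set.univ)) (𝓝 μ) (𝓝 ((δ : ℝ≥0∞) ^ p)) := by
    have hmi : ∀ i, Tendsto (fun ν => m i μ Set.univ - m i ν Set.univ) (𝓝 μ) (𝓝 0) := fun i => by
      have h := (ProbabilityMeasure.tendsto_iff_forall_lintegral_tendsto.1
        (tendsto_id (α := ProbabilityMeasure X) (x := 𝓝 μ)))
        (BoundedContinuousFunction.mkOfCompact (φ i))
      have hmu : ∀ ν, m i ν Set.univ = ∫⁻ x, φ i x ∂(ν : Measure X) := fun ν => by simp [m]
      have hne : m i μ Set.univ ≠ ∞ := by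
        refine ((Finset.single_le_sum (f := fun i => m i μ Set.univ)
          (fun _ _ => zero_le) (Finset.mem_univ i)).trans_lt ?_).ne
        rw [← Measure.finsetSum_apply, hm μ]
        exact measure_lt_top _ _
      rw [← tsub_self (m i μ Set.univ)]
      refine ENNReal.Tendsto.sub tendsto_const_nhds ?_ (Or.inl hne)
      simp only [hmu]
      exact h
    have hs := tendsto_finsetSum Finset.univ fun i _ => hmi i
    rw [Finset.sum_const_zero] at hs
    simpa using tendsto_const_nhds.add (ENNReal.Tendsto.const_mul hs (Or.inr
      (ENNReal.rpow_ne_top_of_nonneg hp.le ENNReal.ofReal_ne_top)))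
  filter_upwards [hlim.eventually_lt_const (ENNReal.rpow_lt_rpow hδ hp)] with ν hν
  obtain ⟨γ, hγ, hle⟩ := exists_mem_transportPlans_lintegral_le (hm μ) (hm ν)
    (fun i => hmS i μ) (fun i => hmS i ν) hball hD hp.le
  rw [wassersteinEDist, one_div, ENNReal.rpow_inv_lt_iff hp]
  exact (iInf₂_le γ hγ).trans_lt (hle.trans_lt hν)

theorem WassersteinSpace.compactSpace {d : ℕ} {Ω : Set (EuclideanSpace ℝ (Fin d))} {p : ℝ}
    (hp : 1 ≤ p) (hΩ : IsCompact Ω) : CompactSpace (WassersteinSpace Ω p) := by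
  have hp₀ : 0 < p := by linarith
  have : CompactSpace Ω := isCompact_iff_compactSpace.1 hΩ
  obtain ⟨C, hC⟩ := hΩ.isBounded.exists_norm_le
  have hmom : ∀ μ : ProbabilityMeasure Ω,
      ∫⁻ x : Ω, ‖(x : EuclideanSpace ℝ (Fin d))‖ₑ ^ p ∂(μ : Measure Ω) < ∞ := fun μ => by
    calc ∫⁻ x : Ω, ‖(x : EuclideanSpace ℝ (Fin d))‖ₑ ^ p ∂(μ : Measure Ω)
        ≤ ∫⁻ _ : Ω, ENNReal.ofReal C ^ p ∂(μ : Measure Ω) := by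
          refine lintegral_mono fun x => ENNReal.rpow_le_rpow ?_ hp₀.le
          rw [← ofReal_norm]
          exact ENNReal.ofReal_le_ofReal (hC x x.2)
      _ < ∞ := by
          rw [lintegral_const, measure_univ, mul_one]
          exact ENNReal.rpow_lt_top_of_nonneg hp₀.le ENNReal.ofReal_ne_top
  let e : ProbabilityMeasure Ω → WassersteinSpace Ω p := fun μ => ⟨μ, hmom μ⟩
  have he : Continuous e := by
    -- The domain carries the weak topology, in which probability measures on a compact metric space
    -- form a compact space.
    refine continuous_def.2 fun U hU => isOpen_iff_mem_nhds.2 fun μ hμ => ?_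
    obtain ⟨ε, hε, hεU⟩ := hU (e μ) hμ
    filter_upwards [eventually_wassersteinEDist_lt hp₀ μ hε] with ν hν
    exact hεU (e ν) hν
  have hsurj : Function.Surjective e := fun μ => ⟨μ.toProb, rfl⟩
  exact hsurj.compactSpace he

end Compact

theorem mainTheorem8 {d : ℕ} (Ω : Set (EuclideanSpace ℝ (Fin d))) (hΩ : MeasurableSet Ω) :
    (∀ p : ℝ, 1 ≤ p →
      (CompactSpace (WassersteinSpace Ω p) ↔ IsCompact Ω) ∧
      (¬ Bornology.IsBounded Ω → ¬ WeaklyLocallyCompactSpace (WassersteinSpace Ω p))) ∧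
    (Ω.Nontrivial →
      ¬ CompactSpace (WassersteinSpaceInfty Ω) ∧
      (¬ DiscreteTopology Ω → ¬ WeaklyLocallyCompactSpace (WassersteinSpaceInfty Ω))) :=
  ⟨fun _ hp => ⟨⟨fun _ => WassersteinSpace.isCompact_of_compactSpace hp,
      WassersteinSpace.compactSpace hp⟩, WassersteinSpace.not_weaklyLocallyCompactSpace hp⟩,
    fun h => ⟨WassersteinSpaceInfty.not_compactSpace h,
      WassersteinSpaceInfty.not_weaklyLocallyCompactSpace⟩⟩
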